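/- Consider a two-sided queue with server types $i\in[n]$, customer types $j\in[m]$ and a set $E\subseteq[n]\times[m]$ of compatible pairs. Type $i$ servers arrive as a Poisson process of rate $\mu_i\in\mathrm{dom}(G_i)\subseteq[0,\infty)$ when each is paid the price $G_i(\mu_i)$, and type $j$ customers arrive as a Poisson process of rate $\lambda_j\in\mathrm{dom}(F_j)\subseteq[0,\infty)$ when each is charged the price $F_j(\lambda_j)$. At positive rates the supply curves $G_i$ are strictly increasing and twice continuously differentiable and the demand curves $F_j$ are strictly decreasing and twice continuously differentiable; $x\mapsto xG_i(x)$ is convex and $x\mapsto xF_j(x)$ is concave on the (interval) domain, and a rate $0$ contributes no revenue and no cost. Let $q^{(1)}_i$ and $q^{(2)}_j$ be the numbers of waiting servers and customers. Each waiting agent costs $s\ge 0$ per unit of time, so that in state $q$ at rates $\lambda,\mu$ the profit rate is $$\sum_j F_j(\lambda_j)\lambda_j-\sum_i G_i(\mu_i)\mu_i-s\Big(\sum_i q^{(1)}_i+\sum_j q^{(2)}_j\Big).$$ The fluid problem is to maximize $\sum_jF_j(\lambda_j)\lambda_j-\sum_iG_i(\mu_i)\mu_i$ over $\lambda_j\in\mathrm{dom}(F_j)$,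 $\mu_i\in\mathrm{dom}(G_i)$ and $\chi\in\mathbb R_{\ge0}^{n\times m}$ with $\lambda_j=\sum_i\chi_{ij}$, $\mu_i=\sum_j\chi_{ij}$, and $\chi_{ij}=0$ for $(i,j)\notin E$. Assume that it has an optimal solution $(\lambda^*,\mu^*,\chi^*)$. For $\eta\in\mathbb N$, $\eta\ge1$, the $\eta$-th system has the same $E$ and $s$ and the curves $F_j^\eta,G_i^\eta$ given by $F^\eta_j(\eta x)=F_j(x)$ and $G^\eta_i(\eta x)=G_i(x)$ (with domains scaled by $\eta$); let $\pi_*^\eta$ be the optimal value of its fluid problem. Fix $\gamma>0$ and put $q_{\max}^\eta=\gamma\sqrt\eta$. Under the fluid pricing policy, type $j$ customers arrive at rate $\eta\lambda_j^*$ while $q^{(2)}_j<q_{\max}^\eta$ and at rate $0$ otherwise, and type $i$ servers arrive at rate $\eta\mu_i^*$ while $q^{(1)}_i<q_{\max}^\eta$ and at rate $0$ otherwise. Under max-weight matching, an arriving agent is matched at once to an agent of a compatible type whose queue is longest if some compatible queue is nonempty (ties are broken arbitrarily, as a function of the state and of the arriving type), and both leave; otherwise the arriving agent joins its own queue. **Theorem.**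 For every $\eta\ge1$ the fluid optimum $\pi_*^\eta$ is attained. Under fluid pricing and max-weight matching, the continuous-time Markov chain of queue lengths has a stationary distribution $\nu^\eta$ whose support is the communicating class of the empty state, and from every state of that class the long-run average profit exists and equals the expected profit rate under $\nu^\eta$. The profit loss $L^\eta$, that is, $\pi_*^\eta$ minus this long-run average profit, satisfies $$L^\eta=O(\sqrt\eta)\qquad(\eta\to\infty).$$ Moreover, the blocking probabilities $\nu^\eta(q^{(1)}_i\ge q_{\max}^\eta)$ and $\nu^\eta(q^{(2)}_j\ge q_{\max}^\eta)$ are $O(1/\sqrt\eta)$ for all $i$ and $j$, and the expected total queue length under $\nu^\eta$ is $O(\sqrt\eta)$. -/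

import Mathlib

open Filter Topology Asymptotics

/-- A two-sided queueing system with server types `Fin n` and customer types `Fin m`:
the compatibility edges, the supply curves `G i` (price as a function of the server arrival rate)
with their domains, the demand curves `F j` (price as a function of the customer arrival rate)
with their domains, and the holding cost `s` per waiting agent and unit of time. -/
structure TwoSidedQueue (n m : ℕ) where
  E : Finset (Fin n × Fin m)
  G : Fin n → ℝ → ℝ
  domG : Fin n → Set ℝ
  F : Fin m → ℝ → ℝ
  domF : Fin m → Set ℝ
  s : ℝ

/-- Queue lengths: `q.1 i` servers of type `i` and `q.2 j` customers of type `j` are waiting. -/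
abbrev QState (n m : ℕ) : Type := (Fin n → ℕ) × (Fin m → ℕ)

namespace TwoSidedQueue

variable {n m : ℕ}

/-- The standing assumptions: rates are nonnegative; supply curves are strictly increasing and
`C²`, demand curves strictly decreasing and `C²`; the cost `x * G i x` is convex and the revenue
`x * F j x` is concave; the holding cost is nonnegative. Monotonicity and smoothness are asked for
only at positive rates, so that curves such as `F x = 4 / √x` or `G x = √x` are covered: the price
at rate `0` is immaterial, because it enters only through the product `0 * F j 0 = 0`. -/
structure Regular (M : TwoSidedQueue n m) : Prop where
  domG_nonneg : ∀ i, M.domG i ⊆ Set.Ici 0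
  domF_nonneg : ∀ j, M.domF j ⊆ Set.Ici 0
  strictMono_G : ∀ i, StrictMonoOn (M.G i) (M.domG i ∩ Set.Ioi 0)
  strictAnti_F : ∀ j, StrictAntiOn (M.F j) (M.domF j ∩ Set.Ioi 0)
  contDiff_G : ∀ i, ContDiffOn ℝ 2 (M.G i) (M.domG i ∩ Set.Ioi 0)
  contDiff_F : ∀ j, ContDiffOn ℝ 2 (M.F j) (M.domF j ∩ Set.Ioi 0)
  convex_cost : ∀ i, ConvexOn ℝ (M.domG i) (fun x => x * M.G i x)
  concave_revenue : ∀ j, ConcaveOn ℝ (M.domF j) (fun x => x * M.F j x)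
  s_nonneg : 0 ≤ M.s

/-- The `η`-th system of the asymptotic regime: `F^η (η x) = F x` and `G^η (η x) = G x`, with
domains scaled accordingly, on the same graph and with the same holding cost. -/
noncomputable def scale (M : TwoSidedQueue n m) (η : ℕ) : TwoSidedQueue n m where
  E := M.E
  G := fun i x => M.G i (x / η)
  domG := fun i => {x | x / η ∈ M.domG i}
  F := fun j x => M.F j (x / η)
  domF := fun j => {x | x / η ∈ M.domF j}
  s := M.s

/-! ### The fluid problem -/

/-- Feasibility of customer rates `lam`, server rates `mu` and matching rates `chi`. -/
structure FluidFeasible (M : TwoSidedQueue n m)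
    (lam : Fin m → ℝ) (mu : Fin n → ℝ) (chi : Fin n → Fin m → ℝ) : Prop where
  lam_mem : ∀ j, lam j ∈ M.domF j
  mu_mem : ∀ i, mu i ∈ M.domG i
  lam_eq : ∀ j, lam j = ∑ i, chi i j
  mu_eq : ∀ i, mu i = ∑ j, chi i j
  chi_eq_zero : ∀ i j, (i, j) ∉ M.E → chi i j = 0
  chi_nonneg : ∀ i j, (i, j) ∈ M.E → 0 ≤ chi i j

/-- Revenue rate from customers minus payment rate to servers. -/
noncomputable def netRevenue (M : TwoSidedQueue n m) (lam : Fin m → ℝ) (mu : Fin n → ℝ) : ℝ :=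
  ∑ j, M.F j (lam j) * lam j - ∑ i, M.G i (mu i) * mu i

/-- The values attained by the fluid objective on the feasible set. -/
def fluidValues (M : TwoSidedQueue n m) : Set ℝ :=
  {v | ∃ lam mu chi, M.FluidFeasible lam mu chi ∧ v = M.netRevenue lam mu}

/-- `(lam, mu, chi)` is an optimal solution of the fluid problem. -/
def FluidOptimal (M : TwoSidedQueue n m)
    (lam : Fin m → ℝ) (mu : Fin n → ℝ) (chi : Fin n → Fin m → ℝ) : Prop :=
  M.FluidFeasible lam mu chi ∧ IsGreatest M.fluidValues (M.netRevenue lam mu)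

end TwoSidedQueue

/-! ### Policies and the controlled Markov chain -/

/-- A matching rule that acts at arrivals: the waiting customer type (if any) to which a server
of type `i` arriving in state `q` is matched, and likewise for arriving customers. -/
structure MatchingRule (n m : ℕ) where
  server : QState n m → Fin n → Option (Fin m)
  customer : QState n m → Fin m → Option (Fin n)

/-- Max-weight matching on the graph `E`: an arrival is matched to a longest nonempty compatible
queue of the other side, with ties broken arbitrarily, and joins its own queue exactly when all
compatible queues are empty. -/
structure MatchingRule.IsMaxWeight {n m : ℕ} (E : Finset (Fin n × Fin m))
    (x : MatchingRule n m) : Prop where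
  server_none : ∀ q i, x.server q i = none → ∀ j, (i, j) ∈ E → q.2 j = 0
  server_some : ∀ q i j, x.server q i = some j →
    (i, j) ∈ E ∧ 0 < q.2 j ∧ ∀ j', (i, j') ∈ E → q.2 j' ≤ q.2 j
  customer_none : ∀ q j, x.customer q j = none → ∀ i, (i, j) ∈ E → q.1 i = 0
  customer_some : ∀ q j i, x.customer q j = some i →
    (i, j) ∈ E ∧ 0 < q.1 i ∧ ∀ i', (i', j) ∈ E → q.1 i' ≤ q.1 i

/-- A stationary joint policy: state-dependent arrival rates (equivalently, prices) and a
matching rule. -/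
structure Policy (n m : ℕ) where
  serverRate : QState n m → Fin n → ℝ
  customerRate : QState n m → Fin m → ℝ
  matching : MatchingRule n m

namespace Policy

variable {n m : ℕ}

/-- The state after the arrival of a server of type `i` in state `q`. -/
def afterServer (P : Policy n m) (q : QState n m) (i : Fin n) : QState n m :=
  match P.matching.server q i with
  | none => (Function.update q.1 i (q.1 i + 1), q.2)
  | some j => (q.1, Function.update q.2 j (q.2 j - 1))

/-- The state after the arrival of a customer of type `j` in state `q`. -/
def afterCustomer (P : Policy n m) (q : QState n m) (j : Fin m) : QState n m :=
  match P.matching.customer q j with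
  | none => (q.1, Function.update q.2 j (q.2 j + 1))
  | some i => (Function.update q.1 i (q.1 i - 1), q.2)

/-- The generator `Q` of the continuous-time Markov chain of queue lengths, acting on
functions. -/
noncomputable def generator (P : Policy n m) (f : QState n m → ℝ) (q : QState n m) : ℝ :=
  ∑ i, P.serverRate q i * (f (P.afterServer q i) - f q) +
    ∑ j, P.customerRate q j * (f (P.afterCustomer q j) - f q)

/-- The entry `Q(q, q')` of the transition rate matrix. -/
noncomputable def rateMatrix (P : Policy n m) (q q' : QState n m) : ℝ :=
  P.generator (Pi.single q' 1) q

/-- The transition probability `ℙ(q(t) = q' | q(0) = q) = (exp (t Q))(q, q')`; the series converges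
for every policy with bounded rates. -/
noncomputable def transitionProb (P : Policy n m) (t : ℝ) (q q' : QState n m) : ℝ :=
  ∑' k : ℕ, t ^ k / (k.factorial : ℝ) * (P.generator^[k] (Pi.single q' 1)) q

/-- One possible transition of the chain. -/
def Step (P : Policy n m) (q q' : QState n m) : Prop :=
  (∃ i, 0 < P.serverRate q i ∧ q' = P.afterServer q i) ∨
    (∃ j, 0 < P.customerRate q j ∧ q' = P.afterCustomer q j)

/-- The communicating class of the empty state. -/
def zeroClass (P : Policy n m) : Set (QState n m) :=
  {q | Relation.ReflTransGen P.Step 0 q ∧ Relation.ReflTransGen P.Step q 0}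

/-- `ν` is the stationary distribution of the chain on the communicating class of the empty state:
a probability distribution whose support is that class and which satisfies `ν Q = 0`. For a chain
with bounded rates, it exists if and only if that class is positive recurrent. -/
structure IsStationaryLaw (P : Policy n m) (ν : QState n m → ℝ) : Prop where
  nonneg : ∀ q, 0 ≤ ν q
  hasSum_one : HasSum ν 1
  balance : ∀ q', HasSum (fun q => ν q * P.rateMatrix q q') 0
  support_eq : Function.support ν = P.zeroClass

/-- Expected profit rate in state `q`: revenue from customers, minus payment to servers, minus
holding cost. -/
noncomputable def profitRate (P : Policy n m) (M : TwoSidedQueue n m) (q : QState n m) : ℝ :=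
  M.netRevenue (P.customerRate q) (P.serverRate q) -
    M.s * (∑ i, (q.1 i : ℝ) + ∑ j, (q.2 j : ℝ))

/-- The long-run average profit `lim_{T → ∞} T⁻¹ ∫₀ᵀ 𝔼[profit rate at q(t) | q(0) = q₀] dt`
exists and equals `g`. -/
def HasLongRunProfit (P : Policy n m) (M : TwoSidedQueue n m) (q₀ : QState n m) (g : ℝ) : Prop :=
  Tendsto (fun T : ℝ => T⁻¹ * ∫ t in (0 : ℝ)..T, ∑' q, P.transitionProb t q₀ q * P.profitRate M q)
    atTop (𝓝 g)

end Policy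

/-- The fluid pricing policy with base rates `lam`, `mu` and buffer threshold `b`: a type is
admitted at its base rate while its queue is shorter than `b`, and is closed (rate `0`)
otherwise. It is combined with the matching rule `x`. -/
noncomputable def fluidPolicy {n m : ℕ} (lam : Fin m → ℝ) (mu : Fin n → ℝ) (b : ℝ)
    (x : MatchingRule n m) : Policy n m where
  serverRate := fun q i => if (q.1 i : ℝ) < b then mu i else 0
  customerRate := fun q j => if (q.2 j : ℝ) < b then lam j else 0
  matching := x

/-!
The fluid optimum is positively homogeneous in `η`: scaling rates by `η` is a bijection between the
feasible points of the original and the `η`-th fluid problem and multiplies the objective by `η`.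
So the fluid optimum is attained with value `η` times the original one.

Started empty, the chain keeps compatible queues from being nonempty together and every queue below
the threshold plus one, hence it lives in a finite box. The matching rates `chi` give every type of
positive rate a compatible type of positive rate, whose queue is empty, and so open, whenever the
former waits; therefore each reachable state leads back to the empty one
(`IsBalancedFlow.reaches_zero`), and the communicating class of the empty state is finite and
closed.

On a finite irreducible class, a stationary law exists because the absolute value of a left null
vector of the rate matrix `Q` is again one (`IsIrreducibleRateMatrix.exists_stationary`). Long-run
averages converge by the Poisson equation `r = Q h + c`, which turns the integral of `exp (t Q) r`
over `[0, T]` into `c T` plus a bounded term (`IsIrreducibleRateMatrix.tendsto_average`).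

The quantitative part is a Lyapunov argument with the sum of squared queue lengths. Under max-weight
matching, an open server type `i` contributes at most `2 (q.1 i - q.2 j) + 1` for every compatible
`j`, and symmetrically for customers; averaging against `chi` cancels the linear terms, and only the
missing arrivals of blocked types remain, each blocked type contributing about minus `2 b` times its
rate, where `b = γ √η` is the threshold (`IsBalancedFlow.generator_sumSq_le`). As the mean drift
vanishes, rate times blocking probability is at most the total rate divided by `b`, so that blocking
probabilities are `O(1 / √η)`. The profit lost to blocking is `η` times such probabilities, and the
holding cost is `O(b)` because all queues are at most `b + 1`.
-/

/-! ### Finite irreducible rate matrices -/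

section RateMatrix

open Matrix NormedSpace

variable {S : Type*} [Fintype S]

/-- A rate matrix (`Q`-matrix) on a finite state space: off-diagonal entries are nonnegative, rows
sum to zero, and every state leads to every other one along positive entries. -/
structure IsIrreducibleRateMatrix (Q : Matrix S S ℝ) : Prop where
  offDiag_nonneg : ∀ s t, s ≠ t → 0 ≤ Q s t
  row_sum : ∀ s, ∑ t, Q s t = 0
  irreducible : ∀ s t, Relation.ReflTransGen (fun a b => 0 < Q a b) s t

namespace IsIrreducibleRateMatrix

variable {Q : Matrix S S ℝ}

/-- Harmonic functions are constant: by the maximum principle, the set where a harmonic function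
is maximal is closed under transitions. -/
theorem eq_of_mulVec_eq_zero (hQ : IsIrreducibleRateMatrix Q) {f : S → ℝ} (hf : Q *ᵥ f = 0)
    (s t : S) : f s = f t := by
  obtain ⟨a, ha⟩ := (have : Nonempty S := ⟨s⟩; Finite.exists_max f)
  have key : ∀ u, f u = f a := by
    intro u
    induction hQ.irreducible a u with
    | refl => rfl
    | @tail b c _ hbc ih =>
      have h0 : ∑ v, Q b v * (f a - f v) = 0 := by
        have := congrFun hf b
        simp only [mulVec, dotProduct, Pi.zero_apply] at this
        simp [mul_sub, Finset.sum_sub_distrib, ← Finset.sum_mul, hQ.row_sum, this]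
      have hnn : ∀ v ∈ Finset.univ, 0 ≤ Q b v * (f a - f v) := by
        intro v _
        by_cases hbv : b = v
        · subst hbv; simp [ih]
        · exact mul_nonneg (hQ.offDiag_nonneg b v hbv) (sub_nonneg.2 (ha v))
      have := (Finset.sum_eq_zero_iff_of_nonneg hnn).1 h0 c (Finset.mem_univ c)
      rcases mul_eq_zero.1 this with h | h
      · exact absurd h hbc.ne'
      · linarith
  rw [key s, key t]

/-- A nonnegative nonzero stationary vector is positive everywhere. -/
theorem pos_of_vecMul_eq_zero (hQ : IsIrreducibleRateMatrix Q) {w : S → ℝ} (hw : ∀ s, 0 ≤ w s)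
    (hw0 : w ≠ 0) (hwQ : w ᵥ* Q = 0) (t : S) : 0 < w t := by
  obtain ⟨a, ha⟩ := Function.ne_iff.1 hw0
  induction hQ.irreducible a t with
  | refl => exact lt_of_le_of_ne (hw a) (Ne.symm ha)
  | @tail b c _ hbc ih =>
    refine lt_of_le_of_ne (hw c) fun hc => ?_
    have h0 : ∑ s, w s * Q s c = 0 := congrFun hwQ c
    have hnn : ∀ s ∈ Finset.univ, 0 ≤ w s * Q s c := by
      intro s _
      by_cases hsc : s = c
      · subst hsc; simp [← hc]
      · exact mul_nonneg (hw s) (hQ.offDiag_nonneg s c hsc)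
    have := (Finset.sum_eq_zero_iff_of_nonneg hnn).1 h0 b (Finset.mem_univ b)
    exact (mul_pos ih hbc).ne' this

/-- Existence of a positive stationary distribution. The matrix is singular because it kills
constants; if `v` is a nonzero left null vector, then `|v|` satisfies `0 ≤ |v| Q`
entrywise, and equality holds because the entries of `|v| Q` sum to zero. -/
theorem exists_stationary (hQ : IsIrreducibleRateMatrix Q) [Nonempty S] :
    ∃ w : S → ℝ, (∀ s, 0 < w s) ∧ ∑ s, w s = 1 ∧ w ᵥ* Q = 0 := by
  classical
  obtain ⟨v, hv0, hv⟩ : ∃ v : S → ℝ, v ≠ 0 ∧ v ᵥ* Q = 0 := by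
    rw [exists_vecMul_eq_zero_iff, ← exists_mulVec_eq_zero_iff]
    refine ⟨fun _ => 1, ?_, ?_⟩
    · intro h
      simpa using congrFun h (Classical.arbitrary S)
    · ext s
      simp [mulVec, dotProduct, hQ.row_sum]
  set a : S → ℝ := fun s => |v s| with ha
  have hnn : ∀ t, 0 ≤ (a ᵥ* Q) t := by
    intro t
    have h0 : ∑ s, v s * Q s t = 0 := congrFun hv t
    have : ∑ s, ((SignType.sign (v t) : ℝ) * (v s * Q s t)) ≤ ∑ s, |v s| * Q s t := by
      refine Finset.sum_le_sum fun s _ => ?_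
      by_cases hst : s = t
      · subst hst
        rw [← mul_assoc, sign_mul_self]
      · rw [← mul_assoc]
        refine mul_le_mul_of_nonneg_right ?_ (hQ.offDiag_nonneg s t hst)
        rcases lt_trichotomy (v t) 0 with h | h | h
        · simp [h, neg_le_abs]
        · simp [h]
        · simp [h, le_abs_self]
    rw [← Finset.mul_sum, h0, mul_zero] at this
    exact this
  have hsum : ∑ t, (a ᵥ* Q) t = 0 := by
    simp only [vecMul, dotProduct]
    rw [Finset.sum_comm]
    simp [← Finset.mul_sum, hQ.row_sum]
  have haQ : a ᵥ* Q = 0 := by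
    ext t
    exact (Finset.sum_eq_zero_iff_of_nonneg fun t _ => hnn t).1 hsum t (Finset.mem_univ t)
  have ha0 : a ≠ 0 := by
    intro h
    apply hv0
    ext s
    simpa [ha] using congrFun h s
  have hpos := hQ.pos_of_vecMul_eq_zero (fun s => abs_nonneg (v s)) ha0 haQ
  have hS : 0 < ∑ s, a s := Finset.sum_pos (fun s _ => hpos s) Finset.univ_nonempty
  refine ⟨(∑ s, a s)⁻¹ • a, fun s => ?_, ?_, ?_⟩
  · exact mul_pos (inv_pos.2 hS) (hpos s)
  · simp only [Pi.smul_apply, smul_eq_mul, ← Finset.mul_sum]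
    exact inv_mul_cancel₀ hS.ne'
  · rw [smul_vecMul, haQ, smul_zero]

/-- Solvability of the Poisson equation `r = Q h + c`, with `c` the stationary mean of `r`. The
range of `Q` meets its kernel (the constants) only in `0`, since the stationary distribution
annihilates the range but not the constants. -/
theorem exists_poisson (hQ : IsIrreducibleRateMatrix Q) {w : S → ℝ}
    (hw1 : ∑ s, w s = 1) (hwQ : w ᵥ* Q = 0) (r : S → ℝ) :
    ∃ h : S → ℝ, ∀ s, r s = (Q *ᵥ h) s + w ⬝ᵥ r := by
  classical
  have hann : ∀ h : S → ℝ, w ⬝ᵥ (Q *ᵥ h) = 0 := fun h => by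
    rw [dotProduct_mulVec, hwQ, zero_dotProduct]
  have hconst : ∀ f : S → ℝ, (∀ s t, f s = f t) → ∀ s, f s = w ⬝ᵥ f := by
    intro f hf s
    have : w ⬝ᵥ f = ∑ t, w t * f s := Finset.sum_congr rfl fun t _ => by rw [hf t s]
    rw [this, ← Finset.sum_mul, hw1, one_mul]
  have hdisj : Disjoint (LinearMap.range Q.mulVecLin) (LinearMap.ker Q.mulVecLin) := by
    rw [Submodule.disjoint_def]
    rintro f ⟨h, rfl⟩ hf
    have hc := hconst _ (hQ.eq_of_mulVec_eq_zero (f := Q.mulVecLin h) (by simpa using hf))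
    ext s
    rw [hc s]
    exact hann h
  have htop := Submodule.eq_top_of_disjoint _ _
    (LinearMap.finrank_range_add_finrank_ker Q.mulVecLin).ge hdisj
  obtain ⟨y, ⟨h, hy⟩, z, hz, hyz⟩ := Submodule.mem_sup.1
    (htop ▸ Submodule.mem_top : r ∈ LinearMap.range Q.mulVecLin ⊔ LinearMap.ker Q.mulVecLin)
  refine ⟨h, fun s => ?_⟩
  have hy' : Q *ᵥ h = y := hy
  have hzc := hconst z (hQ.eq_of_mulVec_eq_zero hz) s
  rw [← hyz, dotProduct_add, ← hy', hann h, zero_add, ← hzc]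
  rfl

section Exponential

variable [DecidableEq S]

attribute [local instance] Matrix.linftyOpNormedRing Matrix.linftyOpNormedAlgebra

/-- In a real Banach algebra, `‖exp (x + a)‖ ≤ e ^ (‖x‖ + a)` for scalars `a` of either sign. -/
theorem _root_.norm_exp_add_algebraMap_le {𝔸 : Type*} [NormedRing 𝔸] [NormedAlgebra ℝ 𝔸]
    [CompleteSpace 𝔸] [NormOneClass 𝔸] (x : 𝔸) (a : ℝ) :
    ‖exp (x + algebraMap ℝ 𝔸 a)‖ ≤ Real.exp (‖x‖ + a) := by
  have hx : ‖exp x‖ ≤ Real.exp ‖x‖ := by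
    rw [Real.exp_eq_exp_ℝ, ← (exp_series_hasSum_exp' (𝕂 := ℝ) x).tsum_eq]
    refine tsum_of_norm_bounded (exp_series_hasSum_exp' (𝕂 := ℝ) ‖x‖) fun k => ?_
    rw [norm_smul, smul_eq_mul, Real.norm_of_nonneg (by positivity)]
    exact mul_le_mul_of_nonneg_left (norm_pow_le _ _) (by positivity)
  let _ : NormedAlgebra ℚ 𝔸 := .restrictScalars ℚ ℝ 𝔸
  rw [NormedSpace.exp_add_of_commute (Algebra.commutes a x).symm, ← algebraMap_exp_comm,
    Real.exp_add, Real.exp_eq_exp_ℝ]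
  refine (norm_mul_le _ _).trans ?_
  rw [← Real.exp_eq_exp_ℝ, norm_algebraMap', Real.norm_of_nonneg (Real.exp_pos _).le]
  exact mul_le_mul_of_nonneg_right hx (Real.exp_pos _).le

/-- Kolmogorov's equation for `exp (t Q) f`, entrywise. -/
theorem _root_.Matrix.hasDerivAt_exp_smul_mulVec (Q : Matrix S S ℝ) (f : S → ℝ) (t : ℝ) (s : S) :
    HasDerivAt (fun t : ℝ => (exp (t • Q) *ᵥ f) s) ((exp (t • Q) *ᵥ (Q *ᵥ f)) s) t := by
  let L : Matrix S S ℝ →ₗ[ℝ] ℝ :=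
    { toFun := fun B => (B *ᵥ f) s
      map_add' := fun B C => by rw [add_mulVec]; rfl
      map_smul' := fun a B => by rw [smul_mulVec]; rfl }
  rw [mulVec_mulVec]
  exact (LinearMap.toContinuousLinearMap L).hasFDerivAt.comp_hasDerivAt t
    (hasDerivAt_exp_smul_const (𝕂 := ℝ) Q t)

/-- The transition semigroup `exp (t Q)` is a contraction for the supremum norm. With `c` large
enough that `Q + c` is entrywise nonnegative, `Q + c` has norm at most `c`, and
`exp (t Q) = exp (-t c) exp (t (Q + c))`. -/
theorem norm_exp_smul_le_one (hQ : IsIrreducibleRateMatrix Q) [Nonempty S] {t : ℝ} (ht : 0 ≤ t) :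
    ‖exp (t • Q)‖ ≤ 1 := by
  have : NormOneClass (Matrix S S ℝ) := ⟨by
    rw [← diagonal_one, linfty_opNorm_diagonal, pi_norm_const, norm_one]⟩
  set c : ℝ := ∑ s, |Q s s| with hc
  have hc0 : 0 ≤ c := Finset.sum_nonneg fun s _ => abs_nonneg _
  set A : Matrix S S ℝ := Q + c • (1 : Matrix S S ℝ) with hA
  have hAnn : ∀ s u, 0 ≤ A s u := by
    intro s u
    by_cases hsu : s = u
    · subst hsu
      have : |Q s s| ≤ c :=
        Finset.single_le_sum (f := fun s => |Q s s|) (fun s _ => abs_nonneg _) (Finset.mem_univ s)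
      have h2 := neg_abs_le (Q s s)
      simp [hA]
      linarith
    · simpa [hA, hsu] using hQ.offDiag_nonneg s u hsu
  have hArow : ∀ s, ∑ u, A s u = c := by
    intro s
    simp [hA, Finset.sum_add_distrib, hQ.row_sum, Matrix.one_apply]
  have hAnorm : ‖A‖ ≤ c := by
    lift c to NNReal using hc0 with c' hc'
    rw [← coe_nnnorm, linfty_opNNNorm_def, NNReal.coe_le_coe]
    refine Finset.sup_le fun s _ => ?_
    rw [← NNReal.coe_le_coe]
    push_cast
    refine le_of_eq ?_
    rw [← hArow s]
    exact Finset.sum_congr rfl fun u _ => by rw [Real.norm_of_nonneg (hAnn s u)]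
  have hsplit : t • Q = t • A + algebraMap ℝ (Matrix S S ℝ) (-(t * c)) := by
    rw [Algebra.algebraMap_eq_smul_one, hA]
    module
  have hexp := norm_exp_add_algebraMap_le (t • A) (-(t * c))
  rw [← hsplit] at hexp
  refine hexp.trans ?_
  rw [norm_smul, Real.norm_of_nonneg ht, Real.exp_le_one_iff]
  nlinarith [mul_le_mul_of_nonneg_left hAnorm ht]

/-- The entries of `exp (t Q)` as power series. -/
theorem _root_.Matrix.exp_smul_apply_eq_tsum (Q : Matrix S S ℝ) (t : ℝ) (s u : S) :
    exp (t • Q) s u = ∑' k : ℕ, t ^ k / (k.factorial : ℝ) * (Q ^ k) s u := by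
  have h := exp_series_hasSum_exp' (𝕂 := ℝ) (t • Q)
  have h2 : HasSum (fun k : ℕ => ((k.factorial⁻¹ : ℝ) • (t • Q) ^ k) s u) (exp (t • Q) s u) :=
    h.map (Matrix.entryAddMonoidHom ℝ s u) (continuous_id.matrix_elem s u)
  rw [← h2.tsum_eq]
  refine tsum_congr fun k => ?_
  rw [smul_pow]
  simp only [Matrix.smul_apply, smul_eq_mul]
  ring

/-- The ergodic theorem in mean. By the Poisson equation `r = Q h + c`, the integral of
`exp (t Q) r` over `[0, T]` is `c T + exp (T Q) h - h`, and `exp (T Q) h` stays bounded. -/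
theorem tendsto_average (hQ : IsIrreducibleRateMatrix Q) {w : S → ℝ}
    (hw1 : ∑ s, w s = 1) (hwQ : w ᵥ* Q = 0) (r : S → ℝ) (s : S) :
    Tendsto (fun T : ℝ => T⁻¹ * ∫ t in (0 : ℝ)..T, (exp (t • Q) *ᵥ r) s) atTop
      (𝓝 (w ⬝ᵥ r)) := by
  have : Nonempty S := ⟨s⟩
  obtain ⟨h, hh⟩ := hQ.exists_poisson hw1 hwQ r
  set c := w ⬝ᵥ r with hc
  have hone : ∀ t : ℝ, exp (t • Q) *ᵥ (fun _ => c) = fun _ => c := by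
    have hQ1 : Q *ᵥ (fun _ => c) = 0 := by
      ext u; simp [mulVec, dotProduct, ← Finset.sum_mul, hQ.row_sum]
    intro t
    ext u
    have hd : ∀ x : ℝ, HasDerivAt (fun t : ℝ => (exp (t • Q) *ᵥ (fun _ => c)) u) 0 x := by
      intro x
      have := hasDerivAt_exp_smul_mulVec Q (fun _ => c) x u
      rwa [hQ1, mulVec_zero] at this
    have := is_const_of_deriv_eq_zero (fun x => (hd x).differentiableAt) (fun x => (hd x).deriv) t 0
    rw [this]
    simp
  have hr : r = Q *ᵥ h + fun _ => c := by ext u; exact hh u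
  have hint : ∀ T : ℝ, ∫ t in (0 : ℝ)..T, (exp (t • Q) *ᵥ r) s
      = (exp (T • Q) *ᵥ h) s - h s + c * T := by
    intro T
    have hd : ∀ t : ℝ, HasDerivAt (fun t : ℝ => (exp (t • Q) *ᵥ h) s + c * t)
        ((exp (t • Q) *ᵥ r) s) t := by
      intro t
      have := (hasDerivAt_exp_smul_mulVec Q h t s).add ((hasDerivAt_id t).const_mul c)
      rw [hr, mulVec_add, hone]
      rw [mul_one] at this
      exact this
    have hcont : Continuous fun t : ℝ => (exp (t • Q) *ᵥ r) s :=
      continuous_iff_continuousAt.2 fun t => (hasDerivAt_exp_smul_mulVec Q r t s).continuousAt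
    rw [intervalIntegral.integral_eq_sub_of_hasDerivAt (fun t _ => hd t)
      (hcont.intervalIntegrable _ _)]
    simp
    ring
  have hbdd : ∀ T : ℝ, 0 ≤ T → ‖(exp (T • Q) *ᵥ h) s - h s‖ ≤ 2 * ‖h‖ := by
    intro T hT
    have h1 : ‖(exp (T • Q) *ᵥ h) s‖ ≤ ‖h‖ :=
      (norm_le_pi_norm _ s).trans <| (linfty_opNorm_mulVec _ _).trans <|
        mul_le_of_le_one_left (norm_nonneg _) (hQ.norm_exp_smul_le_one hT)
    have h2 := norm_le_pi_norm h s
    have := norm_sub_le ((exp (T • Q) *ᵥ h) s) (h s)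
    linarith
  have hlim : Tendsto (fun T : ℝ => T⁻¹ * ((exp (T • Q) *ᵥ h) s - h s)) atTop (𝓝 0) := by
    refine squeeze_zero_norm' (a := fun T : ℝ => T⁻¹ * (2 * ‖h‖)) ?_ ?_
    · filter_upwards [eventually_ge_atTop 0] with T hT
      rw [norm_mul, Real.norm_of_nonneg (inv_nonneg.2 hT)]
      exact mul_le_mul_of_nonneg_left (hbdd T hT) (inv_nonneg.2 hT)
    · simpa using tendsto_inv_atTop_zero.mul_const (2 * ‖h‖)
  have hlim2 := hlim.add_const c
  rw [zero_add] at hlim2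
  refine hlim2.congr' ?_
  filter_upwards [eventually_gt_atTop 0] with T hT
  rw [hint]
  field_simp

end Exponential

end IsIrreducibleRateMatrix

end RateMatrix

/-! ### Chains with a finite closed communicating class -/

namespace Policy

open Matrix

variable {n m : ℕ} {P : Policy n m}

/-- The standing hypotheses for the finite theory: rates are nonnegative, and the communicating
class of the empty state is finite and closed under transitions. -/
structure HasFiniteClosedClass (P : Policy n m) : Prop where
  serverRate_nonneg : ∀ q i, 0 ≤ P.serverRate q i
  customerRate_nonneg : ∀ q j, 0 ≤ P.customerRate q j
  finite : P.zeroClass.Finite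
  closed : ∀ q ∈ P.zeroClass, ∀ q', P.Step q q' → q' ∈ P.zeroClass

/-- The transition rate matrix restricted to the communicating class of the empty state. -/
noncomputable def classMatrix (P : Policy n m) : Matrix P.zeroClass P.zeroClass ℝ :=
  fun q q' => P.rateMatrix q q'

theorem zero_mem_zeroClass (P : Policy n m) : (0 : QState n m) ∈ P.zeroClass :=
  ⟨.refl, .refl⟩

/-- Only states in a closed class enter the generator at a state of that class. -/
theorem generator_eq_zero_of_eqOn (hP : P.HasFiniteClosedClass) {f : QState n m → ℝ}
    (hf : ∀ q ∈ P.zeroClass, f q = 0) {q : QState n m} (hq : q ∈ P.zeroClass) :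
    P.generator f q = 0 := by
  unfold generator
  rw [Finset.sum_eq_zero, Finset.sum_eq_zero, add_zero]
  · intro j _
    rcases (hP.customerRate_nonneg q j).eq_or_lt with h | h
    · rw [← h, zero_mul]
    · rw [hf _ hq, hf _ (hP.closed q hq _ (.inr ⟨j, h, rfl⟩)), sub_zero, mul_zero]
  · intro i _
    rcases (hP.serverRate_nonneg q i).eq_or_lt with h | h
    · rw [← h, zero_mul]
    · rw [hf _ hq, hf _ (hP.closed q hq _ (.inl ⟨i, h, rfl⟩)), sub_zero, mul_zero]

theorem generator_sub (P : Policy n m) (f g : QState n m → ℝ) (q : QState n m) :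
    P.generator (f - g) q = P.generator f q - P.generator g q := by
  simp only [generator, Pi.sub_apply]
  rw [add_sub_add_comm, ← Finset.sum_sub_distrib, ← Finset.sum_sub_distrib]
  congr 1 <;> exact Finset.sum_congr rfl fun _ _ => by ring

theorem generator_sum_smul {ι : Type*} (P : Policy n m) (t : Finset ι) (c : ι → ℝ)
    (f : ι → QState n m → ℝ) (q : QState n m) :
    P.generator (fun q => ∑ a ∈ t, c a * f a q) q = ∑ a ∈ t, c a * P.generator (f a) q := by
  simp only [generator, mul_add, Finset.mul_sum, Finset.sum_add_distrib, ← Finset.sum_sub_distrib]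
  congr 1
  · rw [Finset.sum_comm]
    exact Finset.sum_congr rfl fun _ _ => Finset.sum_congr rfl fun _ _ => by ring
  · rw [Finset.sum_comm]
    exact Finset.sum_congr rfl fun _ _ => Finset.sum_congr rfl fun _ _ => by ring

/-- On the class, the generator acts as the restricted rate matrix. -/
theorem generator_eq_mulVec [Fintype P.zeroClass] (hP : P.HasFiniteClosedClass)
    (f : QState n m → ℝ) (q : P.zeroClass) :
    P.generator f q = (P.classMatrix *ᵥ fun q' => f q') q := by
  have h1 : P.generator (fun q => ∑ a : P.zeroClass,
      f a * (Pi.single (a : QState n m) (1 : ℝ) : QState n m → ℝ) q) q =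
      (P.classMatrix *ᵥ fun q' => f q') q := by
    rw [generator_sum_smul]
    exact Finset.sum_congr rfl fun a _ => mul_comm _ _
  rw [← h1, ← sub_eq_zero, ← generator_sub]
  refine generator_eq_zero_of_eqOn hP (fun p hp => ?_) q.2
  rw [Pi.sub_apply, sub_eq_zero, Finset.sum_eq_single ⟨p, hp⟩]
  · simp
  · intro b _ hb
    have : p ≠ b := fun h => hb (Subtype.ext h.symm)
    rw [Pi.single_eq_of_ne this, mul_zero]
  · simp

theorem iterate_generator_eq [Fintype P.zeroClass] [DecidableEq P.zeroClass]
    (hP : P.HasFiniteClosedClass) (f : QState n m → ℝ) (k : ℕ) (q : P.zeroClass) :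
    (P.generator^[k] f) q = ((P.classMatrix ^ k) *ᵥ fun q' => f q') q := by
  induction k generalizing q with
  | zero => simp
  | succ k ih =>
    rw [Function.iterate_succ_apply', generator_eq_mulVec hP, pow_succ', ← mulVec_mulVec]
    congr 2
    ext q'
    exact ih q'

/-- Expectations along the chain started in the class are given by the matrix exponential. -/
theorem tsum_transitionProb_mul [Fintype P.zeroClass] [DecidableEq P.zeroClass]
    (hP : P.HasFiniteClosedClass) (t : ℝ) (q : P.zeroClass) (f : QState n m → ℝ) :
    ∑' q', P.transitionProb t q q' * f q'
      = (NormedSpace.exp (t • P.classMatrix) *ᵥ fun q' => f q') q := by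
  have hsupp : (Function.support fun q' => P.transitionProb t q q' * f q') ⊆ P.zeroClass := by
    intro q' hq'
    by_contra hn
    refine hq' ?_
    have : P.transitionProb t q q' = 0 := by
      unfold transitionProb
      rw [← tsum_zero (α := ℝ) (β := ℕ)]
      refine tsum_congr fun k => ?_
      rw [iterate_generator_eq hP]
      have h0 : (fun p : P.zeroClass => (Pi.single q' (1 : ℝ) : QState n m → ℝ) p) = 0 := by
        ext p
        exact Pi.single_eq_of_ne (fun h : (p : QState n m) = q' => hn (h ▸ p.2)) _
      rw [h0, mulVec_zero, Pi.zero_apply, mul_zero]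
    simp [this]
  rw [← tsum_subtype_eq_of_support_subset hsupp, tsum_fintype]
  refine Finset.sum_congr rfl fun q' _ => ?_
  congr 1
  refine Eq.trans ?_ (exp_smul_apply_eq_tsum P.classMatrix t q q').symm
  refine tsum_congr fun k => ?_
  rw [iterate_generator_eq hP]
  have h1 : (fun p : P.zeroClass => (Pi.single (q' : QState n m) (1 : ℝ) : QState n m → ℝ) p)
      = Pi.single q' 1 := by
    ext p
    by_cases h : p = q'
    · subst h; simp
    · rw [Pi.single_eq_of_ne h, Pi.single_eq_of_ne (fun h' => h (Subtype.ext h'))]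
  rw [h1, mulVec_single_one]
  rfl

theorem rateMatrix_nonneg (hP : P.HasFiniteClosedClass) {q q' : QState n m} (h : q ≠ q') :
    0 ≤ P.rateMatrix q q' := by
  have hs : ∀ p, 0 ≤ (Pi.single q' (1 : ℝ) : QState n m → ℝ) p := fun p =>
    (Pi.single_nonneg.2 zero_le_one : (0 : QState n m → ℝ) ≤ Pi.single q' 1) p
  unfold rateMatrix generator
  simp only [Pi.single_eq_of_ne h, sub_zero]
  exact add_nonneg
    (Finset.sum_nonneg fun i _ => mul_nonneg (hP.serverRate_nonneg q i) (hs _))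
    (Finset.sum_nonneg fun j _ => mul_nonneg (hP.customerRate_nonneg q j) (hs _))

theorem rateMatrix_pos (hP : P.HasFiniteClosedClass) {q q' : QState n m} (h : q ≠ q')
    (hstep : P.Step q q') : 0 < P.rateMatrix q q' := by
  have hs : ∀ p, 0 ≤ (Pi.single q' (1 : ℝ) : QState n m → ℝ) p := fun p =>
    (Pi.single_nonneg.2 zero_le_one : (0 : QState n m → ℝ) ≤ Pi.single q' 1) p
  have h1 : ∀ i ∈ Finset.univ, 0 ≤ P.serverRate q i *
      (Pi.single q' (1 : ℝ) : QState n m → ℝ) (P.afterServer q i) :=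
    fun i _ => mul_nonneg (hP.serverRate_nonneg q i) (hs _)
  have h2 : ∀ j ∈ Finset.univ, 0 ≤ P.customerRate q j *
      (Pi.single q' (1 : ℝ) : QState n m → ℝ) (P.afterCustomer q j) :=
    fun j _ => mul_nonneg (hP.customerRate_nonneg q j) (hs _)
  unfold rateMatrix generator
  simp only [Pi.single_eq_of_ne h, sub_zero]
  rcases hstep with ⟨i, hi, rfl⟩ | ⟨j, hj, rfl⟩
  · refine add_pos_of_pos_of_nonneg (Finset.sum_pos' h1 ⟨i, Finset.mem_univ i, ?_⟩)
      (Finset.sum_nonneg h2)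
    simpa using hi
  · refine add_pos_of_nonneg_of_pos (Finset.sum_nonneg h1)
      (Finset.sum_pos' h2 ⟨j, Finset.mem_univ j, ?_⟩)
    simpa using hj

theorem classMatrix_isIrreducible [Fintype P.zeroClass] (hP : P.HasFiniteClosedClass) :
    IsIrreducibleRateMatrix P.classMatrix where
  offDiag_nonneg s t hst := rateMatrix_nonneg hP fun h => hst (Subtype.ext h)
  row_sum s := by
    have := generator_eq_mulVec hP (fun _ => 1) s
    simpa [generator, mulVec, dotProduct] using this.symm
  irreducible s t := by
    -- Any path of the chain that starts in the class stays in it.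
    have key : ∀ (a : P.zeroClass) (b : QState n m), Relation.ReflTransGen P.Step a b →
        ∃ hb : b ∈ P.zeroClass,
          Relation.ReflTransGen (fun a b => 0 < P.classMatrix a b) a ⟨b, hb⟩ := by
      intro a b hab
      induction hab with
      | refl => exact ⟨a.2, .refl⟩
      | @tail b c _ hbc ih =>
        obtain ⟨hb, hpath⟩ := ih
        refine ⟨hP.closed b hb c hbc, ?_⟩
        by_cases h : b = c
        · subst h; exact hpath
        · exact hpath.tail (rateMatrix_pos hP h hbc)
    obtain ⟨_, h1⟩ := key s 0 s.2.2
    obtain ⟨_, h2⟩ := key ⟨0, P.zero_mem_zeroClass⟩ t t.2.1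
    exact h1.trans h2

/-- A chain whose zero class is finite and closed has a stationary law on that class; the generator
has mean zero under it, and long-run average profits are its means of the profit rate. -/
theorem HasFiniteClosedClass.exists_stationaryLaw (hP : P.HasFiniteClosedClass) :
    ∃ ν : QState n m → ℝ, P.IsStationaryLaw ν ∧
      (∀ f, ∑ q ∈ hP.finite.toFinset, ν q * P.generator f q = 0) ∧
      ∀ M : TwoSidedQueue n m, ∀ q₀ ∈ P.zeroClass,
        P.HasLongRunProfit M q₀ (∑ q ∈ hP.finite.toFinset, ν q * P.profitRate M q) := by
  classical
  have : Fintype P.zeroClass := hP.finite.fintype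
  have : Nonempty P.zeroClass := ⟨⟨0, P.zero_mem_zeroClass⟩⟩
  have hQ := classMatrix_isIrreducible hP
  obtain ⟨w, hwpos, hw1, hwQ⟩ := hQ.exists_stationary
  set ν : QState n m → ℝ := fun q => if h : q ∈ P.zeroClass then w ⟨q, h⟩ else 0 with hν
  have hνw : ∀ q : P.zeroClass, ν q = w q := fun q => by simp [hν]
  have hν0 : ∀ q ∉ P.zeroClass, ν q = 0 := fun q hq => by simp [hν, hq]
  have hsum : ∀ f : QState n m → ℝ,
      ∑ q ∈ hP.finite.toFinset, ν q * f q = w ⬝ᵥ fun q : P.zeroClass => f q := by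
    intro f
    rw [Finset.sum_subtype hP.finite.toFinset (p := (· ∈ P.zeroClass)) (fun q => by simp)]
    exact Finset.sum_congr rfl fun q _ => by rw [hνw]
  have hHasSum : ∀ f : QState n m → ℝ, HasSum (fun q => ν q * f q)
      (w ⬝ᵥ fun q : P.zeroClass => f q) := by
    intro f
    rw [← hsum]
    refine hasSum_sum_of_ne_finset_zero fun q hq => ?_
    rw [hν0 q (by simpa using hq), zero_mul]
  have hgen : ∀ f, (w ⬝ᵥ fun q : P.zeroClass => P.generator f q) = 0 := by
    intro f
    have : (fun q : P.zeroClass => P.generator f q) = P.classMatrix *ᵥ fun q' => f q' :=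
      funext fun q => generator_eq_mulVec hP f q
    rw [this, dotProduct_mulVec, hwQ, zero_dotProduct]
  refine ⟨ν, ⟨fun q => ?_, ?_, fun q' => ?_, ?_⟩, fun f => ?_, fun M q₀ hq₀ => ?_⟩
  · by_cases h : q ∈ P.zeroClass
    · exact (hwpos ⟨q, h⟩).le.trans_eq (hνw ⟨q, h⟩).symm
    · exact (hν0 q h).ge
  · have := hHasSum fun _ => 1
    simpa [dotProduct, hw1] using this
  · have := hHasSum fun q => P.rateMatrix q q'
    rwa [show (w ⬝ᵥ fun q : P.zeroClass => P.rateMatrix q q') = 0 from hgen _] at this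
  · ext q
    by_cases h : q ∈ P.zeroClass
    · simpa [h] using ((hwpos ⟨q, h⟩).trans_eq (hνw ⟨q, h⟩).symm).ne'
    · simpa [h] using hν0 q h
  · rw [hsum, hgen]
  · unfold HasLongRunProfit
    rw [hsum]
    have := hQ.tendsto_average hw1 hwQ (fun q => P.profitRate M q) ⟨q₀, hq₀⟩
    simpa only [← tsum_transitionProb_mul hP] using this

end Policy

/-! ### Fluid pricing with max-weight matching at fixed rates -/

/-- Arrival rates `lam`, `mu` that are balanced by matching rates `chi` along the edges of `E`. -/
structure IsBalancedFlow {n m : ℕ} (E : Finset (Fin n × Fin m)) (lam : Fin m → ℝ) (mu : Fin n → ℝ)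
    (chi : Fin n → Fin m → ℝ) : Prop where
  nonneg : ∀ i j, 0 ≤ chi i j
  mem_of_ne_zero : ∀ i j, chi i j ≠ 0 → (i, j) ∈ E
  lam_eq : ∀ j, lam j = ∑ i, chi i j
  mu_eq : ∀ i, mu i = ∑ j, chi i j

/-- The invariant of the chain started empty: compatible queues are never both nonempty, types of
rate zero have empty queues, and no queue exceeds the threshold by more than one. -/
structure QState.Admissible {n m : ℕ} (E : Finset (Fin n × Fin m)) (lam : Fin m → ℝ)
    (mu : Fin n → ℝ) (b : ℝ) (q : QState n m) : Prop where
  disjoint : ∀ i j, (i, j) ∈ E → q.1 i = 0 ∨ q.2 j = 0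
  mu_pos : ∀ i, q.1 i ≠ 0 → 0 < mu i
  lam_pos : ∀ j, q.2 j ≠ 0 → 0 < lam j
  server_le : ∀ i, (q.1 i : ℝ) ≤ b + 1
  customer_le : ∀ j, (q.2 j : ℝ) ≤ b + 1

/-- The Lyapunov function: the sum of the squared queue lengths. -/
noncomputable def QState.sumSq {n m : ℕ} (q : QState n m) : ℝ :=
  ∑ i, (q.1 i : ℝ) ^ 2 + ∑ j, (q.2 j : ℝ) ^ 2

namespace Policy

variable {n m : ℕ} {P : Policy n m} {q : QState n m} {i : Fin n} {j : Fin m}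

theorem afterServer_of_eq_none (h : P.matching.server q i = none) :
    P.afterServer q i = (Function.update q.1 i (q.1 i + 1), q.2) := by
  simp [afterServer, h]

theorem afterServer_of_eq_some (h : P.matching.server q i = some j) :
    P.afterServer q i = (q.1, Function.update q.2 j (q.2 j - 1)) := by
  simp [afterServer, h]

theorem afterCustomer_of_eq_none (h : P.matching.customer q j = none) :
    P.afterCustomer q j = (q.1, Function.update q.2 j (q.2 j + 1)) := by
  simp [afterCustomer, h]

theorem afterCustomer_of_eq_some (h : P.matching.customer q j = some i) :
    P.afterCustomer q j = (Function.update q.1 i (q.1 i - 1), q.2) := by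
  simp [afterCustomer, h]

end Policy

theorem Fintype.sum_update_eq {ι α : Type*} [Fintype ι] [DecidableEq ι] (g : α → ℝ) (f : ι → α)
    (i : ι) (a : α) : ∑ k, g (Function.update f i a k) = ∑ k, g (f k) + (g a - g (f i)) := by
  rw [← Finset.add_sum_erase _ _ (Finset.mem_univ i),
    ← Finset.add_sum_erase _ _ (Finset.mem_univ i)]
  rw [Function.update_self, Finset.sum_congr rfl (g := fun k => g (f k)) fun k hk => by
    rw [Function.update_of_ne (Finset.ne_of_mem_erase hk)]]
  ring

namespace IsBalancedFlow

variable {n m : ℕ} {E : Finset (Fin n × Fin m)} {lam : Fin m → ℝ} {mu : Fin n → ℝ}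
  {chi : Fin n → Fin m → ℝ} {b : ℝ} {x : MatchingRule n m}

theorem lam_nonneg (hf : IsBalancedFlow E lam mu chi) (j : Fin m) : 0 ≤ lam j :=
  hf.lam_eq j ▸ Finset.sum_nonneg fun i _ => hf.nonneg i j

theorem mu_nonneg (hf : IsBalancedFlow E lam mu chi) (i : Fin n) : 0 ≤ mu i :=
  hf.mu_eq i ▸ Finset.sum_nonneg fun j _ => hf.nonneg i j

theorem exists_edge_of_mu_pos (hf : IsBalancedFlow E lam mu chi) {i : Fin n} (hi : 0 < mu i) :
    ∃ j, (i, j) ∈ E ∧ 0 < lam j := by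
  rw [hf.mu_eq i] at hi
  obtain ⟨j, -, hj⟩ := Finset.exists_ne_zero_of_sum_ne_zero hi.ne'
  refine ⟨j, hf.mem_of_ne_zero i j hj, hf.lam_eq j ▸ ?_⟩
  exact Finset.sum_pos' (fun k _ => hf.nonneg k j)
    ⟨i, Finset.mem_univ i, lt_of_le_of_ne (hf.nonneg i j) hj.symm⟩

theorem exists_edge_of_lam_pos (hf : IsBalancedFlow E lam mu chi) {j : Fin m} (hj : 0 < lam j) :
    ∃ i, (i, j) ∈ E ∧ 0 < mu i := by
  rw [hf.lam_eq j] at hj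
  obtain ⟨i, -, hi⟩ := Finset.exists_ne_zero_of_sum_ne_zero hj.ne'
  refine ⟨i, hf.mem_of_ne_zero i j hi, hf.mu_eq i ▸ ?_⟩
  exact Finset.sum_pos' (fun k _ => hf.nonneg i k)
    ⟨j, Finset.mem_univ j, lt_of_le_of_ne (hf.nonneg i j) hi.symm⟩

theorem _root_.QState.Admissible.step (hx : x.IsMaxWeight E)
    {q q' : QState n m} (hq : q.Admissible E lam mu b) (hs : (fluidPolicy lam mu b x).Step q q') :
    q'.Admissible E lam mu b := by
  rcases hs with ⟨i, hi, rfl⟩ | ⟨j, hj, rfl⟩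
  · have hib : (q.1 i : ℝ) < b ∧ 0 < mu i := by
      by_cases h : (q.1 i : ℝ) < b
      · exact ⟨h, by simpa [fluidPolicy, h] using hi⟩
      · simp [fluidPolicy, h] at hi
    cases hxi : x.server q i with
    | none =>
      rw [Policy.afterServer_of_eq_none (P := fluidPolicy lam mu b x) hxi]
      have h0 := hx.server_none q i hxi
      refine ⟨fun i' j' he => ?_, fun i' hi' => ?_, hq.lam_pos, fun i' => ?_, hq.customer_le⟩
      · by_cases h : i' = i
        · subst h; exact .inr (h0 j' he)
        · simpa [h] using hq.disjoint i' j' he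
      · by_cases h : i' = i
        · subst h; exact hib.2
        · exact hq.mu_pos i' (by simpa [h] using hi')
      · by_cases h : i' = i
        · subst h; simpa using hib.1.le
        · simpa [h] using hq.server_le i'
    | some j =>
      rw [Policy.afterServer_of_eq_some (P := fluidPolicy lam mu b x) hxi]
      refine ⟨fun i' j' he => ?_, hq.mu_pos, fun j' hj' => ?_, hq.server_le, fun j' => ?_⟩
      · rcases hq.disjoint i' j' he with h | h
        · exact .inl h
        · refine .inr ?_
          by_cases h' : j' = j
          · subst h'; simp [h]
          · simpa [h'] using h
      · by_cases h : j' = j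
        · subst h
          refine hq.lam_pos j' fun h0 => ?_
          simp [h0] at hj'
        · exact hq.lam_pos j' (by simpa [h] using hj')
      · by_cases h : j' = j
        · subst h
          refine le_trans ?_ (hq.customer_le j')
          simp
        · simpa [h] using hq.customer_le j'
  · have hjb : (q.2 j : ℝ) < b ∧ 0 < lam j := by
      by_cases h : (q.2 j : ℝ) < b
      · exact ⟨h, by simpa [fluidPolicy, h] using hj⟩
      · simp [fluidPolicy, h] at hj
    cases hxj : x.customer q j with
    | none =>
      rw [Policy.afterCustomer_of_eq_none (P := fluidPolicy lam mu b x) hxj]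
      have h0 := hx.customer_none q j hxj
      refine ⟨fun i' j' he => ?_, hq.mu_pos, fun j' hj' => ?_, hq.server_le, fun j' => ?_⟩
      · by_cases h : j' = j
        · subst h; exact .inl (h0 i' he)
        · simpa [h] using hq.disjoint i' j' he
      · by_cases h : j' = j
        · subst h; exact hjb.2
        · exact hq.lam_pos j' (by simpa [h] using hj')
      · by_cases h : j' = j
        · subst h; simpa using hjb.1.le
        · simpa [h] using hq.customer_le j'
    | some i =>
      rw [Policy.afterCustomer_of_eq_some (P := fluidPolicy lam mu b x) hxj]
      refine ⟨fun i' j' he => ?_, fun i' hi' => ?_, hq.lam_pos, fun i' => ?_, hq.customer_le⟩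
      · rcases hq.disjoint i' j' he with h | h
        · refine .inl ?_
          by_cases h' : i' = i
          · subst h'; simp [h]
          · simpa [h'] using h
        · exact .inr h
      · by_cases h : i' = i
        · subst h
          refine hq.mu_pos i' fun h0 => ?_
          simp [h0] at hi'
        · exact hq.mu_pos i' (by simpa [h] using hi')
      · by_cases h : i' = i
        · subst h
          refine le_trans ?_ (hq.server_le i')
          simp
        · simpa [h] using hq.server_le i'

theorem _root_.QState.Admissible.of_reachable (hx : x.IsMaxWeight E)
    (hb : 0 < b) {q : QState n m}
    (hq : Relation.ReflTransGen (fluidPolicy lam mu b x).Step 0 q) :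
    q.Admissible E lam mu b := by
  induction hq with
  | refl =>
    exact ⟨fun _ _ _ => .inl rfl, fun _ h => absurd rfl h, fun _ h => absurd rfl h,
      fun _ => by simpa using by linarith, fun _ => by simpa using by linarith⟩
  | tail _ hs ih => exact ih.step hx hs

/-- From a nonempty admissible state, some arrival with positive rate lowers the total queue
length: a waiting agent has positive rate, hence so does a compatible type, and the queue of
that type is empty and therefore open. -/
theorem exists_step_lt (hf : IsBalancedFlow E lam mu chi) (hx : x.IsMaxWeight E) (hb : 0 < b)
    {q : QState n m} (hq : q.Admissible E lam mu b) (h0 : q ≠ 0) :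
    ∃ q', (fluidPolicy lam mu b x).Step q q' ∧
      ∑ i, q'.1 i + ∑ j, q'.2 j < ∑ i, q.1 i + ∑ j, q.2 j := by
  have hne : (∃ i, q.1 i ≠ 0) ∨ ∃ j, q.2 j ≠ 0 := by
    by_contra! h
    exact h0 (Prod.ext (funext h.1) (funext h.2))
  rcases hne with ⟨i, hi⟩ | ⟨j, hj⟩
  · obtain ⟨j, hij, hj⟩ := hf.exists_edge_of_mu_pos (hq.mu_pos i hi)
    have hj0 : q.2 j = 0 := (hq.disjoint i j hij).resolve_left hi
    refine ⟨_, .inr ⟨j, ?_, rfl⟩, ?_⟩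
    · simpa [fluidPolicy, hj0, hb] using hj
    · cases hxj : x.customer q j with
      | none => exact absurd (hx.customer_none q j hxj i hij) hi
      | some i' =>
        rw [Policy.afterCustomer_of_eq_some (P := fluidPolicy lam mu b x) hxj]
        have hpos := (hx.customer_some q j i' hxj).2.1
        refine Nat.add_lt_add_right (Finset.sum_lt_sum (fun k _ => ?_)
          ⟨i', Finset.mem_univ i', by simpa using hpos⟩) _
        by_cases h : k = i'
        · subst h; simp
        · simp [h]
  · obtain ⟨i, hij, hi⟩ := hf.exists_edge_of_lam_pos (hq.lam_pos j hj)
    have hi0 : q.1 i = 0 := (hq.disjoint i j hij).resolve_right hj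
    refine ⟨_, .inl ⟨i, ?_, rfl⟩, ?_⟩
    · simpa [fluidPolicy, hi0, hb] using hi
    · cases hxi : x.server q i with
      | none => exact absurd (hx.server_none q i hxi j hij) hj
      | some j' =>
        rw [Policy.afterServer_of_eq_some (P := fluidPolicy lam mu b x) hxi]
        have hpos := (hx.server_some q i j' hxi).2.1
        refine Nat.add_lt_add_left (Finset.sum_lt_sum (fun k _ => ?_)
          ⟨j', Finset.mem_univ j', by simpa using hpos⟩) _
        by_cases h : k = j'
        · subst h; simp
        · simp [h]

theorem reaches_zero (hf : IsBalancedFlow E lam mu chi) (hx : x.IsMaxWeight E) (hb : 0 < b)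
    {q : QState n m} (hq : q.Admissible E lam mu b) :
    Relation.ReflTransGen (fluidPolicy lam mu b x).Step q 0 := by
  induction hN : ∑ i, q.1 i + ∑ j, q.2 j using Nat.strong_induction_on generalizing q with
  | _ N ih =>
    by_cases h0 : q = 0
    · exact h0 ▸ .refl
    · obtain ⟨q', hs, hlt⟩ := hf.exists_step_lt hx hb hq h0
      exact .head hs (ih _ (hN ▸ hlt) (hq.step hx hs) rfl)

theorem _root_.QState.Admissible.of_mem_zeroClass (hx : x.IsMaxWeight E)
    (hb : 0 < b) {q : QState n m} (hq : q ∈ (fluidPolicy lam mu b x).zeroClass) :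
    q.Admissible E lam mu b :=
  .of_reachable hx hb hq.1

theorem hasFiniteClosedClass (hf : IsBalancedFlow E lam mu chi) (hx : x.IsMaxWeight E)
    (hb : 0 < b) : (fluidPolicy lam mu b x).HasFiniteClosedClass where
  serverRate_nonneg q i := by
    unfold fluidPolicy
    dsimp only
    split_ifs
    exacts [hf.mu_nonneg i, le_rfl]
  customerRate_nonneg q j := by
    unfold fluidPolicy
    dsimp only
    split_ifs
    exacts [hf.lam_nonneg j, le_rfl]
  finite := by
    refine ((Set.finite_Iic fun _ : Fin n => ⌊b + 1⌋₊).prod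
      (Set.finite_Iic fun _ : Fin m => ⌊b + 1⌋₊)).subset ?_
    intro q hq
    have := QState.Admissible.of_mem_zeroClass hx hb hq
    exact ⟨fun i => Nat.le_floor (this.server_le i), fun j => Nat.le_floor (this.customer_le j)⟩
  closed q hq q' hs :=
    ⟨hq.1.tail hs, hf.reaches_zero hx hb
      ((QState.Admissible.of_mem_zeroClass hx hb hq).step hx hs)⟩

/-- The increment of the sum of squares caused by an arriving server, bounded by means of any one
compatible customer type. If the server joins its queue, all compatible queues are empty; if it is
matched, its own queue is empty and the longest compatible queue shrinks; if it is blocked, its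
queue is nonempty, so again all compatible queues are empty. -/
theorem _root_.QState.Admissible.sumSq_afterServer_sub_le (hx : x.IsMaxWeight E)
    (hb : 0 < b) {q : QState n m} (hq : q.Admissible E lam mu b) {i : Fin n} {j : Fin m}
    (hij : (i, j) ∈ E) :
    (if (q.1 i : ℝ) < b then ((fluidPolicy lam mu b x).afterServer q i).sumSq - q.sumSq else 0)
      ≤ 2 * ((q.1 i : ℝ) - q.2 j) + 1 - 2 * b * (if b ≤ q.1 i then 1 else 0) := by
  by_cases h : (q.1 i : ℝ) < b
  · rw [if_pos h, if_neg (not_le.2 h)]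
    cases hxi : x.server q i with
    | none =>
      rw [Policy.afterServer_of_eq_none (P := fluidPolicy lam mu b x) hxi]
      have h0 := hx.server_none q i hxi j hij
      simp only [QState.sumSq]
      rw [Fintype.sum_update_eq (fun a : ℕ => (a : ℝ) ^ 2), h0]
      push_cast
      exact le_of_eq (by ring)
    | some j' =>
      rw [Policy.afterServer_of_eq_some (P := fluidPolicy lam mu b x) hxi]
      obtain ⟨he, hpos, hmax⟩ := hx.server_some q i j' hxi
      have h0 : q.1 i = 0 := (hq.disjoint i j' he).resolve_right hpos.ne'
      have hle : (q.2 j : ℝ) ≤ q.2 j' := by exact_mod_cast hmax j hij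
      simp only [QState.sumSq]
      rw [Fintype.sum_update_eq (fun a : ℕ => (a : ℝ) ^ 2), h0, Nat.cast_sub hpos]
      push_cast
      linarith
  · have hbq := not_lt.1 h
    have hne : q.1 i ≠ 0 := fun h0 => by rw [h0] at hbq; push_cast at hbq; linarith
    rw [if_neg h, if_pos hbq, (hq.disjoint i j hij).resolve_left hne]
    push_cast
    linarith

/-- The counterpart of `QState.Admissible.sumSq_afterServer_sub_le` for an arriving customer. -/
theorem _root_.QState.Admissible.sumSq_afterCustomer_sub_le (hx : x.IsMaxWeight E)
    (hb : 0 < b) {q : QState n m} (hq : q.Admissible E lam mu b) {i : Fin n} {j : Fin m}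
    (hij : (i, j) ∈ E) :
    (if (q.2 j : ℝ) < b then ((fluidPolicy lam mu b x).afterCustomer q j).sumSq - q.sumSq else 0)
      ≤ 2 * ((q.2 j : ℝ) - q.1 i) + 1 - 2 * b * (if b ≤ q.2 j then 1 else 0) := by
  by_cases h : (q.2 j : ℝ) < b
  · rw [if_pos h, if_neg (not_le.2 h)]
    cases hxj : x.customer q j with
    | none =>
      rw [Policy.afterCustomer_of_eq_none (P := fluidPolicy lam mu b x) hxj]
      have h0 := hx.customer_none q j hxj i hij
      simp only [QState.sumSq]
      rw [Fintype.sum_update_eq (fun a : ℕ => (a : ℝ) ^ 2), h0]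
      push_cast
      exact le_of_eq (by ring)
    | some i' =>
      rw [Policy.afterCustomer_of_eq_some (P := fluidPolicy lam mu b x) hxj]
      obtain ⟨he, hpos, hmax⟩ := hx.customer_some q j i' hxj
      have h0 : q.2 j = 0 := (hq.disjoint i' j he).resolve_left hpos.ne'
      have hle : (q.1 i : ℝ) ≤ q.1 i' := by exact_mod_cast hmax i hij
      simp only [QState.sumSq]
      rw [Fintype.sum_update_eq (fun a : ℕ => (a : ℝ) ^ 2), h0, Nat.cast_sub hpos]
      push_cast
      linarith
  · have hbq := not_lt.1 h
    have hne : q.2 j ≠ 0 := fun h0 => by rw [h0] at hbq; push_cast at hbq; linarith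
    rw [if_neg h, if_pos hbq, (hq.disjoint i j hij).resolve_right hne]
    push_cast
    linarith

/-- The drift bound. Weighting the one-step increments by `chi` pairs each server type with the
customer types that serve it, and the linear terms `q.1 i - q.2 j` and `q.2 j - q.1 i` cancel;
what remains is the negative contribution of the blocked types. -/
theorem generator_sumSq_le (hf : IsBalancedFlow E lam mu chi) (hx : x.IsMaxWeight E)
    (hb : 0 < b) {q : QState n m} (hq : q.Admissible E lam mu b) :
    (fluidPolicy lam mu b x).generator QState.sumSq q ≤
      2 * (∑ i, mu i) - 2 * b * (∑ i, mu i * (if b ≤ (q.1 i : ℝ) then 1 else 0) +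
        ∑ j, lam j * (if b ≤ (q.2 j : ℝ) then 1 else 0)) := by
  have hswap : ∀ g : Fin m → ℝ, ∑ j, lam j * g j = ∑ i, ∑ j, chi i j * g j := fun g => by
    rw [Finset.sum_comm]
    exact Finset.sum_congr rfl fun j _ => by rw [hf.lam_eq j, Finset.sum_mul]
  have hmu : ∀ g : Fin n → ℝ, ∑ i, mu i * g i = ∑ i, ∑ j, chi i j * g i := fun g =>
    Finset.sum_congr rfl fun i _ => by rw [hf.mu_eq i, Finset.sum_mul]
  have hgen : (fluidPolicy lam mu b x).generator QState.sumSq q =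
      ∑ i, mu i * (if (q.1 i : ℝ) < b then
        ((fluidPolicy lam mu b x).afterServer q i).sumSq - q.sumSq else 0) +
      ∑ j, lam j * (if (q.2 j : ℝ) < b then
        ((fluidPolicy lam mu b x).afterCustomer q j).sumSq - q.sumSq else 0) := by
    unfold Policy.generator
    congr 1
    · refine Finset.sum_congr rfl fun i _ => ?_
      by_cases h : (q.1 i : ℝ) < b <;> simp [fluidPolicy, h]
    · refine Finset.sum_congr rfl fun j _ => ?_
      by_cases h : (q.2 j : ℝ) < b <;> simp [fluidPolicy, h]
  have hone : ∑ i, mu i = ∑ i, ∑ j, chi i j := Finset.sum_congr rfl fun i _ => hf.mu_eq i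
  rw [hgen, hmu, hswap, hmu, hswap, hone, ← Finset.sum_add_distrib, ← Finset.sum_add_distrib,
    Finset.mul_sum, Finset.mul_sum, ← Finset.sum_sub_distrib]
  refine Finset.sum_le_sum fun i _ => ?_
  rw [← Finset.sum_add_distrib, ← Finset.sum_add_distrib, Finset.mul_sum, Finset.mul_sum,
    ← Finset.sum_sub_distrib]
  refine Finset.sum_le_sum fun j _ => ?_
  by_cases h0 : chi i j = 0
  · simp [h0]
  · have hij := hf.mem_of_ne_zero i j h0
    have h1 := hq.sumSq_afterServer_sub_le hx hb hij
    have h2 := hq.sumSq_afterCustomer_sub_le hx hb hij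
    have := mul_le_mul_of_nonneg_left (add_le_add h1 h2) (hf.nonneg i j)
    linarith

end IsBalancedFlow

/-! ### Estimates under the stationary law -/

/-- The probability that the queue of server type `i` has reached the threshold `b`. -/
noncomputable def serverBlocking {n m : ℕ} (b : ℝ) (ν : QState n m → ℝ) (i : Fin n) : ℝ :=
  ∑' q, if b ≤ (q.1 i : ℝ) then ν q else 0

/-- The probability that the queue of customer type `j` has reached the threshold `b`. -/
noncomputable def customerBlocking {n m : ℕ} (b : ℝ) (ν : QState n m → ℝ) (j : Fin m) : ℝ :=
  ∑' q, if b ≤ (q.2 j : ℝ) then ν q else 0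

/-- The expected total queue length. -/
noncomputable def meanQueue {n m : ℕ} (ν : QState n m → ℝ) : ℝ :=
  ∑' q, ν q * (∑ i, (q.1 i : ℝ) + ∑ j, (q.2 j : ℝ))

/-- What the stationary analysis gives for a fluid policy with threshold `b`. In the bounds on the
blocking probabilities, a type with rate zero is never blocked, in agreement with `a / 0 = 0`. -/
structure IsControlledLaw {n m : ℕ} (lam : Fin m → ℝ) (mu : Fin n → ℝ) (b : ℝ)
    (x : MatchingRule n m) (ν : QState n m → ℝ) : Prop where
  stationary : (fluidPolicy lam mu b x).IsStationaryLaw ν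
  serverBlocking_nonneg : ∀ i, 0 ≤ serverBlocking b ν i
  serverBlocking_le : ∀ i, serverBlocking b ν i ≤ (∑ i, mu i) / (b * mu i)
  customerBlocking_nonneg : ∀ j, 0 ≤ customerBlocking b ν j
  customerBlocking_le : ∀ j, customerBlocking b ν j ≤ (∑ i, mu i) / (b * lam j)
  meanQueue_nonneg : 0 ≤ meanQueue ν
  meanQueue_le : meanQueue ν ≤ (n + m) * (b + 1)
  hasSum_profit : ∀ M : TwoSidedQueue n m,
    HasSum (fun q => ν q * (fluidPolicy lam mu b x).profitRate M q)
      (M.netRevenue lam mu - (∑ j, M.F j (lam j) * lam j * customerBlocking b ν j -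
        ∑ i, M.G i (mu i) * mu i * serverBlocking b ν i) - M.s * meanQueue ν)
  longRun : ∀ (M : TwoSidedQueue n m) (g : ℝ),
    HasSum (fun q => ν q * (fluidPolicy lam mu b x).profitRate M q) g →
    ∀ q₀ ∈ (fluidPolicy lam mu b x).zeroClass, (fluidPolicy lam mu b x).HasLongRunProfit M q₀ g

/-- Blocked types contribute nothing to the profit rate, since a rate `0` has price times rate
equal to `0`. -/
theorem profitRate_fluidPolicy {n m : ℕ} (M : TwoSidedQueue n m) (lam : Fin m → ℝ)
    (mu : Fin n → ℝ) (b : ℝ) (x : MatchingRule n m) (q : QState n m) :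
    (fluidPolicy lam mu b x).profitRate M q = M.netRevenue lam mu -
      (∑ j, M.F j (lam j) * lam j * (if b ≤ (q.2 j : ℝ) then 1 else 0) -
        ∑ i, M.G i (mu i) * mu i * (if b ≤ (q.1 i : ℝ) then 1 else 0)) -
      M.s * (∑ i, (q.1 i : ℝ) + ∑ j, (q.2 j : ℝ)) := by
  have h1 : ∀ j, M.F j (if (q.2 j : ℝ) < b then lam j else 0) *
      (if (q.2 j : ℝ) < b then lam j else 0)
      = M.F j (lam j) * lam j - M.F j (lam j) * lam j * (if b ≤ (q.2 j : ℝ) then 1 else 0) := by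
    intro j
    by_cases h : (q.2 j : ℝ) < b
    · simp [h, not_le.2 h]
    · simp [h, not_lt.1 h]
  have h2 : ∀ i, M.G i (if (q.1 i : ℝ) < b then mu i else 0) *
      (if (q.1 i : ℝ) < b then mu i else 0)
      = M.G i (mu i) * mu i - M.G i (mu i) * mu i * (if b ≤ (q.1 i : ℝ) then 1 else 0) := by
    intro i
    by_cases h : (q.1 i : ℝ) < b
    · simp [h, not_le.2 h]
    · simp [h, not_lt.1 h]
  simp only [Policy.profitRate, TwoSidedQueue.netRevenue, fluidPolicy, h1, h2,
    Finset.sum_sub_distrib]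
  ring

/-- A balanced flow under max-weight matching has a controlled law. The blocking bounds come from
the vanishing mean drift of the sum of squares, the queue bound from the finite box. -/
theorem IsBalancedFlow.exists_isControlledLaw {n m : ℕ} {E : Finset (Fin n × Fin m)}
    {lam : Fin m → ℝ} {mu : Fin n → ℝ} {chi : Fin n → Fin m → ℝ} {b : ℝ} {x : MatchingRule n m}
    (hf : IsBalancedFlow E lam mu chi) (hx : x.IsMaxWeight E) (hb : 0 < b) :
    ∃ ν, IsControlledLaw lam mu b x ν := by
  have hP := hf.hasFiniteClosedClass hx hb
  obtain ⟨ν, hν, hgen, hlong⟩ := hP.exists_stationaryLaw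
  set C := hP.finite.toFinset with hC
  have hadm : ∀ q ∈ C, q.Admissible E lam mu b := fun q hq =>
    .of_mem_zeroClass hx hb (by simpa [hC] using hq)
  have hν0 : ∀ q ∉ C, ν q = 0 := by
    intro q hq
    by_contra h
    have : q ∈ Function.support ν := h
    rw [hν.support_eq] at this
    exact hq (by simpa [hC] using this)
  have hsum : ∀ f : QState n m → ℝ, HasSum (fun q => ν q * f q) (∑ q ∈ C, ν q * f q) := fun f =>
    hasSum_sum_of_ne_finset_zero fun q hq => by rw [hν0 q hq, zero_mul]
  have hone : ∑ q ∈ C, ν q = 1 := by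
    have := (hsum fun _ => 1).unique (by simpa using hν.hasSum_one)
    simpa using this
  have hmean : ∀ {k : ℕ} (c : Fin k → ℝ) (g : Fin k → QState n m → ℝ),
      ∑ i, c i * ∑ q ∈ C, ν q * g i q = ∑ q ∈ C, ν q * ∑ i, c i * g i q := by
    intro k c g
    simp only [Finset.mul_sum]
    rw [Finset.sum_comm]
    exact Finset.sum_congr rfl fun _ _ => Finset.sum_congr rfl fun _ _ => mul_left_comm _ _ _
  have hS : ∀ i, serverBlocking b ν i
      = ∑ q ∈ C, ν q * (if b ≤ (q.1 i : ℝ) then 1 else 0) := fun i => by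
    rw [← (hsum _).tsum_eq]
    exact tsum_congr fun q => by split_ifs <;> simp
  have hCu : ∀ j, customerBlocking b ν j
      = ∑ q ∈ C, ν q * (if b ≤ (q.2 j : ℝ) then 1 else 0) := fun j => by
    rw [← (hsum _).tsum_eq]
    exact tsum_congr fun q => by split_ifs <;> simp
  have hQ : meanQueue ν = ∑ q ∈ C, ν q * (∑ i, (q.1 i : ℝ) + ∑ j, (q.2 j : ℝ)) := (hsum _).tsum_eq
  have hS0 : ∀ i, 0 ≤ serverBlocking b ν i := fun i => hS i ▸
    Finset.sum_nonneg fun q _ => mul_nonneg (hν.nonneg q) (by split_ifs <;> norm_num)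
  have hC0 : ∀ j, 0 ≤ customerBlocking b ν j := fun j => hCu j ▸
    Finset.sum_nonneg fun q _ => mul_nonneg (hν.nonneg q) (by split_ifs <;> norm_num)
  -- The mean drift vanishes, so the drift bound controls the blocking probabilities.
  have hdrift : b * (∑ i, mu i * serverBlocking b ν i + ∑ j, lam j * customerBlocking b ν j)
      ≤ ∑ i, mu i := by
    have h1 : ∑ q ∈ C, ν q * (fluidPolicy lam mu b x).generator QState.sumSq q ≤
        ∑ q ∈ C, ν q * (2 * (∑ i, mu i) - 2 * b *
          (∑ i, mu i * (if b ≤ (q.1 i : ℝ) then 1 else 0) +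
            ∑ j, lam j * (if b ≤ (q.2 j : ℝ) then 1 else 0))) :=
      Finset.sum_le_sum fun q hq =>
        mul_le_mul_of_nonneg_left (hf.generator_sumSq_le hx hb (hadm q hq)) (hν.nonneg q)
    have h2 : ∑ i, mu i * serverBlocking b ν i
        = ∑ q ∈ C, ν q * ∑ i, mu i * (if b ≤ (q.1 i : ℝ) then 1 else 0) := by
      simp only [hS, hmean]
    have h3 : ∑ j, lam j * customerBlocking b ν j
        = ∑ q ∈ C, ν q * ∑ j, lam j * (if b ≤ (q.2 j : ℝ) then 1 else 0) := by
      simp only [hCu, hmean]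
    have h4 : ∑ q ∈ C, ν q * (2 * (∑ i, mu i) - 2 * b *
          (∑ i, mu i * (if b ≤ (q.1 i : ℝ) then 1 else 0) +
            ∑ j, lam j * (if b ≤ (q.2 j : ℝ) then 1 else 0)))
        = 2 * (∑ i, mu i) - 2 * b * (∑ i, mu i * serverBlocking b ν i +
            ∑ j, lam j * customerBlocking b ν j) := by
      simp only [mul_sub, Finset.sum_sub_distrib]
      rw [← Finset.sum_mul, hone, one_mul, h2, h3, ← Finset.sum_add_distrib,
        Finset.mul_sum C]
      congr 1
      exact Finset.sum_congr rfl fun q _ => by ring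
    rw [hgen, h4] at h1
    linarith
  refine ⟨ν, hν, hS0, fun i => ?_, hC0, fun j => ?_, ?_, ?_, fun M => ?_, fun M g hg q₀ hq₀ => ?_⟩
  · rcases (hf.mu_nonneg i).eq_or_lt with h | h
    · -- A server type of rate zero never queues.
      rw [← h, mul_zero, div_zero, hS]
      refine le_of_eq (Finset.sum_eq_zero fun q hq => ?_)
      have h0 : q.1 i = 0 := by
        by_contra hne
        exact ((hadm q hq).mu_pos i hne).ne h
      simp [h0, hb]
    · rw [le_div_iff₀ (mul_pos hb h)]
      refine le_trans ?_ hdrift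
      have h1 : mu i * serverBlocking b ν i ≤ ∑ i, mu i * serverBlocking b ν i :=
        Finset.single_le_sum (f := fun i => mu i * serverBlocking b ν i)
          (fun k _ => mul_nonneg (hf.mu_nonneg k) (hS0 k)) (Finset.mem_univ i)
      have h2 : 0 ≤ ∑ j, lam j * customerBlocking b ν j :=
        Finset.sum_nonneg fun k _ => mul_nonneg (hf.lam_nonneg k) (hC0 k)
      calc _ = b * (mu i * serverBlocking b ν i) := by ring
        _ ≤ _ := mul_le_mul_of_nonneg_left (by linarith) hb.le
  · rcases (hf.lam_nonneg j).eq_or_lt with h | h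
    · rw [← h, mul_zero, div_zero, hCu]
      refine le_of_eq (Finset.sum_eq_zero fun q hq => ?_)
      have h0 : q.2 j = 0 := by
        by_contra hne
        exact ((hadm q hq).lam_pos j hne).ne h
      simp [h0, hb]
    · rw [le_div_iff₀ (mul_pos hb h)]
      refine le_trans ?_ hdrift
      have h1 : lam j * customerBlocking b ν j ≤ ∑ j, lam j * customerBlocking b ν j :=
        Finset.single_le_sum (f := fun j => lam j * customerBlocking b ν j)
          (fun k _ => mul_nonneg (hf.lam_nonneg k) (hC0 k)) (Finset.mem_univ j)
      have h2 : 0 ≤ ∑ i, mu i * serverBlocking b ν i :=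
        Finset.sum_nonneg fun k _ => mul_nonneg (hf.mu_nonneg k) (hS0 k)
      calc _ = b * (lam j * customerBlocking b ν j) := by ring
        _ ≤ _ := mul_le_mul_of_nonneg_left (by linarith) hb.le
  · rw [hQ]
    exact Finset.sum_nonneg fun q _ => mul_nonneg (hν.nonneg q) (by positivity)
  · have h0 : ((n : ℝ) + m) * (b + 1) = ∑ q ∈ C, ν q * ((n + m) * (b + 1)) := by
      rw [← Finset.sum_mul, hone, one_mul]
    rw [hQ, h0]
    refine Finset.sum_le_sum fun q hq => mul_le_mul_of_nonneg_left ?_ (hν.nonneg q)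
    have h1 := Finset.sum_le_sum fun i (_ : i ∈ Finset.univ) => (hadm q hq).server_le i
    have h2 := Finset.sum_le_sum fun j (_ : j ∈ Finset.univ) => (hadm q hq).customer_le j
    simp only [Finset.sum_const, Finset.card_univ, Fintype.card_fin, nsmul_eq_mul] at h1 h2
    linarith
  · convert hsum ((fluidPolicy lam mu b x).profitRate M) using 1
    have h2 : ∑ i, M.G i (mu i) * mu i * serverBlocking b ν i
        = ∑ q ∈ C, ν q * ∑ i, M.G i (mu i) * mu i * (if b ≤ (q.1 i : ℝ) then 1 else 0) := by
      simp only [hS, hmean]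
    have h3 : ∑ j, M.F j (lam j) * lam j * customerBlocking b ν j
        = ∑ q ∈ C, ν q * ∑ j, M.F j (lam j) * lam j * (if b ≤ (q.2 j : ℝ) then 1 else 0) := by
      simp only [hCu, hmean]
    have h4 : M.netRevenue lam mu = ∑ q ∈ C, ν q * M.netRevenue lam mu := by
      rw [← Finset.sum_mul, hone, one_mul]
    rw [h2, h3, h4, hQ, Finset.mul_sum, ← Finset.sum_sub_distrib, ← Finset.sum_sub_distrib,
      ← Finset.sum_sub_distrib]
    refine Finset.sum_congr rfl fun q _ => ?_
    rw [profitRate_fluidPolicy]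
    ring
  · rw [hg.unique (hsum _)]
    exact hlong M q₀ hq₀

/-! ### Scaling -/

namespace TwoSidedQueue

variable {n m : ℕ} {M : TwoSidedQueue n m} {lam : Fin m → ℝ} {mu : Fin n → ℝ}
  {chi : Fin n → Fin m → ℝ}

theorem FluidFeasible.isBalancedFlow (h : M.FluidFeasible lam mu chi) :
    IsBalancedFlow M.E lam mu chi where
  nonneg i j := by
    by_cases he : (i, j) ∈ M.E
    · exact h.chi_nonneg i j he
    · exact (h.chi_eq_zero i j he).ge
  mem_of_ne_zero i j hne := by
    by_contra he
    exact hne (h.chi_eq_zero i j he)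
  lam_eq := h.lam_eq
  mu_eq := h.mu_eq

theorem _root_.IsBalancedFlow.smul {E : Finset (Fin n × Fin m)} (h : IsBalancedFlow E lam mu chi)
    {c : ℝ} (hc : 0 ≤ c) : IsBalancedFlow E (fun j => c * lam j) (fun i => c * mu i)
      (fun i j => c * chi i j) where
  nonneg i j := mul_nonneg hc (h.nonneg i j)
  mem_of_ne_zero i j hne := h.mem_of_ne_zero i j (right_ne_zero_of_mul hne)
  lam_eq j := by rw [h.lam_eq, Finset.mul_sum]
  mu_eq i := by rw [h.mu_eq, Finset.mul_sum]

theorem netRevenue_scale {η : ℕ} (hη : 1 ≤ η) (lam : Fin m → ℝ) (mu : Fin n → ℝ) :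
    (M.scale η).netRevenue (fun j => η * lam j) (fun i => η * mu i)
      = η * M.netRevenue lam mu := by
  have h0 : (η : ℝ) ≠ 0 := by positivity
  simp only [netRevenue, scale, mul_div_cancel_left₀ _ h0, mul_sub, Finset.mul_sum]
  congr 1 <;> exact Finset.sum_congr rfl fun _ _ => by ring

theorem FluidOptimal.isGreatest_scale (h : M.FluidOptimal lam mu chi) {η : ℕ} (hη : 1 ≤ η) :
    IsGreatest (M.scale η).fluidValues (η * M.netRevenue lam mu) := by
  have h0 : (η : ℝ) ≠ 0 := by positivity
  refine ⟨⟨fun j => η * lam j, fun i => η * mu i, fun i j => η * chi i j, ?_,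
    (netRevenue_scale hη lam mu).symm⟩, ?_⟩
  · refine ⟨fun j => ?_, fun i => ?_, fun j => ?_, fun i => ?_, fun i j he => ?_, fun i j he => ?_⟩
    · simpa [scale, h0] using h.1.lam_mem j
    · simpa [scale, h0] using h.1.mu_mem i
    · rw [h.1.lam_eq, Finset.mul_sum]
    · rw [h.1.mu_eq, Finset.mul_sum]
    · rw [h.1.chi_eq_zero i j he, mul_zero]
    · exact mul_nonneg (Nat.cast_nonneg η) (h.1.chi_nonneg i j he)
  · rintro v ⟨lam', mu', chi', hf, rfl⟩
    have hl : lam' = fun j => η * (lam' j / η) := funext fun j => (mul_div_cancel₀ _ h0).symm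
    have hm : mu' = fun i => η * (mu' i / η) := funext fun i => (mul_div_cancel₀ _ h0).symm
    rw [hl, hm, netRevenue_scale hη]
    refine mul_le_mul_of_nonneg_left (h.2.2 ⟨_, _, fun i j => chi' i j / η, ?_, rfl⟩)
      (Nat.cast_nonneg η)
    refine ⟨hf.lam_mem, hf.mu_mem, fun j => ?_, fun i => ?_, fun i j he => ?_, fun i j he => ?_⟩
    · rw [hf.lam_eq, Finset.sum_div]
    · rw [hf.mu_eq, Finset.sum_div]
    · rw [hf.chi_eq_zero i j he, zero_div]
    · exact div_nonneg (hf.chi_nonneg i j he) (Nat.cast_nonneg η)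

end TwoSidedQueue

theorem mainTheorem1 {n m : ℕ} (M : TwoSidedQueue n m) (hM : M.Regular)
    (lam : Fin m → ℝ) (mu : Fin n → ℝ) (chi : Fin n → Fin m → ℝ)
    (hopt : M.FluidOptimal lam mu chi)
    (γ : ℝ) (hγ : 0 < γ)
    (x : ℕ → MatchingRule n m) (hx : ∀ η, (x η).IsMaxWeight M.E)
    (P : ℕ → Policy n m)
    (hP : ∀ η : ℕ, P η =
      fluidPolicy (fun j => (η : ℝ) * lam j) (fun i => (η : ℝ) * mu i) (γ * √(η : ℝ)) (x η)) :
    ∃ (fluidOpt profit : ℕ → ℝ) (ν : ℕ → QState n m → ℝ),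
      (∀ η : ℕ, 1 ≤ η →
        IsGreatest (M.scale η).fluidValues (fluidOpt η) ∧
        (P η).IsStationaryLaw (ν η) ∧
        HasSum (fun q => ν η q * (P η).profitRate (M.scale η) q) (profit η) ∧
        ∀ q₀ ∈ (P η).zeroClass, (P η).HasLongRunProfit (M.scale η) q₀ (profit η)) ∧
      (fun η : ℕ => fluidOpt η - profit η) =O[atTop] (fun η : ℕ => √(η : ℝ)) ∧
      (∀ i, (fun η : ℕ => ∑' q, if γ * √(η : ℝ) ≤ (q.1 i : ℝ) then ν η q else 0)
        =O[atTop] (fun η : ℕ => 1 / √(η : ℝ))) ∧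
      (∀ j, (fun η : ℕ => ∑' q, if γ * √(η : ℝ) ≤ (q.2 j : ℝ) then ν η q else 0)
        =O[atTop] (fun η : ℕ => 1 / √(η : ℝ))) ∧
      (fun η : ℕ => ∑' q, ν η q * (∑ i, (q.1 i : ℝ) + ∑ j, (q.2 j : ℝ)))
        =O[atTop] (fun η : ℕ => √(η : ℝ)) := by
  have hsqrt : ∀ {η : ℕ}, 1 ≤ η → 1 ≤ √(η : ℝ) := fun hη =>
    Real.one_le_sqrt.2 (by exact_mod_cast hη)
  have hex : ∀ η : ℕ, ∃ ν, 1 ≤ η → IsControlledLaw (fun j => (η : ℝ) * lam j)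
      (fun i => (η : ℝ) * mu i) (γ * √(η : ℝ)) (x η) ν := by
    intro η
    by_cases hη : 1 ≤ η
    · obtain ⟨ν, hν⟩ := (hopt.1.isBalancedFlow.smul (Nat.cast_nonneg η)).exists_isControlledLaw
        (hx η) (mul_pos hγ (zero_lt_one.trans_le (hsqrt hη)))
      exact ⟨ν, fun _ => hν⟩
    · exact ⟨0, fun h => absurd h hη⟩
  choose ν hν using hex
  have hbound : ∀ {η : ℕ} (_ : 1 ≤ η) (a : ℝ), (∑ i, (η : ℝ) * mu i) / (γ * √(η : ℝ) * (η * a))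
      = (∑ i, mu i) / (γ * a) * (1 / √(η : ℝ)) := by
    intro η hη a
    have h0 : (η : ℝ) ≠ 0 := by positivity
    rw [← Finset.mul_sum, show γ * √(η : ℝ) * (η * a) = η * (γ * a * √(η : ℝ)) by ring,
      mul_div_mul_left _ _ h0, div_mul_div_comm, mul_one]
  have hserver : ∀ i, (fun η : ℕ => serverBlocking (γ * √(η : ℝ)) (ν η) i)
      =O[atTop] (fun η : ℕ => 1 / √(η : ℝ)) := by
    intro i
    refine IsBigO.of_bound ((∑ i, mu i) / (γ * mu i)) ?_
    filter_upwards [eventually_ge_atTop 1] with η hη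
    rw [Real.norm_of_nonneg ((hν η hη).serverBlocking_nonneg i),
      Real.norm_of_nonneg (by positivity),
      ← hbound hη]
    exact (hν η hη).serverBlocking_le i
  have hcustomer : ∀ j, (fun η : ℕ => customerBlocking (γ * √(η : ℝ)) (ν η) j)
      =O[atTop] (fun η : ℕ => 1 / √(η : ℝ)) := by
    intro j
    refine IsBigO.of_bound ((∑ i, mu i) / (γ * lam j)) ?_
    filter_upwards [eventually_ge_atTop 1] with η hη
    rw [Real.norm_of_nonneg ((hν η hη).customerBlocking_nonneg j),
      Real.norm_of_nonneg (by positivity), ← hbound hη]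
    exact (hν η hη).customerBlocking_le j
  have hqueue : (fun η : ℕ => meanQueue (ν η)) =O[atTop] (fun η : ℕ => √(η : ℝ)) := by
    refine IsBigO.of_bound ((n + m) * (γ + 1)) ?_
    filter_upwards [eventually_ge_atTop 1] with η hη
    rw [Real.norm_of_nonneg (hν η hη).meanQueue_nonneg, Real.norm_of_nonneg (Real.sqrt_nonneg _),
      mul_assoc]
    refine (hν η hη).meanQueue_le.trans (mul_le_mul_of_nonneg_left ?_ (by positivity))
    linarith [hsqrt hη]
  refine ⟨fun η => η * M.netRevenue lam mu, fun η => η * M.netRevenue lam mu -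
    (η : ℝ) * (∑ j, M.F j (lam j) * lam j * customerBlocking (γ * √(η : ℝ)) (ν η) j -
      ∑ i, M.G i (mu i) * mu i * serverBlocking (γ * √(η : ℝ)) (ν η) i) - M.s * meanQueue (ν η),
    ν, fun η hη => ?_, ?_, hserver, hcustomer, hqueue⟩
  · have hsum := (hν η hη).hasSum_profit (M.scale η)
    have h0 : (η : ℝ) ≠ 0 := by positivity
    have hval : ∑ j, (M.scale η).F j (η * lam j) * (η * lam j) *
          customerBlocking (γ * √(η : ℝ)) (ν η) j -
        ∑ i, (M.scale η).G i (η * mu i) * (η * mu i) * serverBlocking (γ * √(η : ℝ)) (ν η) i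
        = (η : ℝ) * (∑ j, M.F j (lam j) * lam j * customerBlocking (γ * √(η : ℝ)) (ν η) j -
          ∑ i, M.G i (mu i) * mu i * serverBlocking (γ * √(η : ℝ)) (ν η) i) := by
      simp only [TwoSidedQueue.scale, mul_div_cancel_left₀ _ h0, mul_sub, Finset.mul_sum]
      congr 1 <;> exact Finset.sum_congr rfl fun _ _ => by ring
    rw [TwoSidedQueue.netRevenue_scale hη, hval] at hsum
    rw [hP η]
    exact ⟨hopt.isGreatest_scale hη, (hν η hη).stationary, hsum, (hν η hη).longRun _ _ hsum⟩
  · have hrev : (fun η : ℕ => ∑ j, M.F j (lam j) * lam j *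
          customerBlocking (γ * √(η : ℝ)) (ν η) j -
        ∑ i, M.G i (mu i) * mu i * serverBlocking (γ * √(η : ℝ)) (ν η) i)
        =O[atTop] (fun η : ℕ => 1 / √(η : ℝ)) :=
      (IsBigO.fun_sum fun j _ => (hcustomer j).const_mul_left _).sub
        (IsBigO.fun_sum fun i _ => (hserver i).const_mul_left _)
    -- Blocking costs `η` times `O(1 / √η)`.
    have hmul := (isBigO_refl (fun η : ℕ => (η : ℝ)) atTop).mul hrev
    simp only [mul_one_div, Real.div_sqrt] at hmul
    refine (hmul.add (hqueue.const_mul_left M.s)).congr_left fun η => ?_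
    ring
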